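/- For a partition $\lambda$ (with first part $\lambda_1$ and length $\ell(\lambda)$) and integers $k,m\ge 0$, let $$s_\lambda(x_1,\dots,x_k;y_1,\dots,y_m)=\sum_{T}\ \prod_{s\in\lambda}\bigl(x_{T(s)}+y_{T(s)+C(s)}\bigr)\Big|_{x_{k+1}=x_{k+2}=\cdots=y_{m+1}=y_{m+2}=\cdots=0}$$ be the super-Schur polynomial, where the sum is over all semistandard tableaux $T$ of shape $\lambda$ with positive integer entries (not bounded by $k$), $T(s)$ is the entry of $T$ in the box $s$, and $C(s)=j-i$ for the box $s$ in row $i$ and column $j$. A subtraction-free arithmetic circuit takes the variables and arbitrary positive integer scalars as inputs; each of its gates performs one addition, multiplication or division, and its size is the number of gates. Theorem 4.3. There is an absolute constant $C$ such that, for all $k,m$ and $\lambda$ with $k\ge\lambda_1+\ell(\lambda)-2$ (and $\ell(\lambda)\le k$ in case $m=0$), the polynomial $s_\lambda(x_1,\dots,x_k;y_1,\dots,y_m)$, as an element of the field of rational functions $\mathbb{Q}(x_1,\dots,x_k,y_1,\dots,y_m)$, is computed by a subtraction-free arithmetic circuit of size at most $C\,(k+m)^3$. -/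

import Mathlib

/-! ### Super-Schur polynomials

Partitions are Young diagrams `μ`; the first part is `μ.rowLen 0` and the length is `μ.colLen 0`.
Everything is indexed from `0`: the tableau entry `a` of Mathlib's `SemistandardYoungTableau`
stands for the positive entry `a + 1`, and the variables are `x_0, …, x_{k-1}` (the generators
`Sum.inl`) and `y_0, …, y_{m-1}` (the generators `Sum.inr`). -/

/-- The variable `x_a`, specialized to `0` if it is not among the first `k` ones. -/
noncomputable def superX (k m a : ℕ) : MvPolynomial (Fin k ⊕ Fin m) ℚ :=
  if h : a < k then MvPolynomial.X (Sum.inl ⟨a, h⟩) else 0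

/-- The variable `y_b`, specialized to `0` if it is not among the first `m` ones. -/
noncomputable def superY (k m b : ℕ) : MvPolynomial (Fin k ⊕ Fin m) ℚ :=
  if h : b < m then MvPolynomial.X (Sum.inr ⟨b, h⟩) else 0

/-- The contribution `∏_s (x_{T(s)} + y_{T(s) + C(s)})` of a semistandard tableau `T`, the product
being over the boxes `s = (i, j)` (row `i`, column `j`), with content `C(s) = j - i`.
The natural-number subtraction is exact, see `SemistandardYoungTableau.row_le_entry`. -/
noncomputable def superTableauWeight (k m : ℕ) {μ : YoungDiagram}
    (T : SemistandardYoungTableau μ) : MvPolynomial (Fin k ⊕ Fin m) ℚ :=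
  ∏ s ∈ μ.cells, (superX k m (T s.1 s.2) + superY k m (T s.1 s.2 + s.2 - s.1))

/-- The super-Schur polynomial `s_μ(x_0, …, x_{k-1}; y_0, …, y_{m-1})`: the sum over all
semistandard tableaux of shape `μ` (the entries are not bounded by `k`), with the variables
`x_k, x_{k+1}, …` and `y_m, y_{m+1}, …` specialized to `0`. Only finitely many tableaux
contribute, see `finite_support_superTableauWeight`. -/
noncomputable def superSchur (k m : ℕ) (μ : YoungDiagram) : MvPolynomial (Fin k ⊕ Fin m) ℚ :=
  ∑ᶠ T : SemistandardYoungTableau μ, superTableauWeight k m T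

theorem SemistandardYoungTableau.row_le_entry {μ : YoungDiagram}
    (T : SemistandardYoungTableau μ) {i j : ℕ} (h : (i, j) ∈ μ) : i ≤ T i j := by
  induction i with
  | zero => exact Nat.zero_le _
  | succ i ih =>
    have h1 : (i, j) ∈ μ := μ.up_left_mem (Nat.le_succ i) le_rfl h
    have h2 := T.col_strict (Nat.lt_add_one i) h
    have h3 := ih h1
    omega

theorem finite_support_superTableauWeight (k m : ℕ) (μ : YoungDiagram) :
    (Function.support
      (superTableauWeight k m : SemistandardYoungTableau μ → _)).Finite := by
  have key : ∀ T ∈ Function.support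
      (superTableauWeight k m : SemistandardYoungTableau μ → _),
      ∀ s : μ.cells, T s.1.1 s.1.2 < k + m + s.1.1 + 1 := by
    intro T hT s
    by_contra hlt
    refine hT (Finset.prod_eq_zero s.2 ?_)
    have h1 : ¬ T s.1.1 s.1.2 < k := by omega
    have h2 : ¬ T s.1.1 s.1.2 + s.1.2 - s.1.1 < m := by omega
    simp [superX, superY, h1, h2]
  let F : SemistandardYoungTableau μ → (μ.cells → ℕ) := fun T s => T s.1.1 s.1.2
  have hF : Function.Injective F := by
    intro T T' h
    ext i j
    by_cases hij : (i, j) ∈ μ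
    · exact congrFun h ⟨(i, j), by simpa using hij⟩
    · rw [T.zeros hij, T'.zeros hij]
  refine Set.Finite.of_finite_image (f := F) ?_ hF.injOn
  refine (Set.Finite.pi' (t := fun s : μ.cells => Set.Iio (k + m + s.1.1 + 1))
    (fun s => Set.finite_Iio _)).subset ?_
  rintro _ ⟨T, hT, rfl⟩ s
  exact key T hT s

/-! ### Subtraction-free arithmetic circuits -/

/-- The operations allowed in a subtraction-free circuit. -/
inductive SFOp where
  | add | mul | div

/-- An operand available to the gate number `i`: an input variable, a positive integer scalar, or
the result of one of the earlier gates `0, …, i - 1`. -/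
inductive SFOperand (σ : Type*) (i : ℕ) where
  | var (v : σ)
  | scalar (c : ℕ+)
  | gate (j : Fin i)

/-- A subtraction-free arithmetic circuit with input variables `σ`: a list of gates, each
performing one arithmetic operation on two operands, in an order in which every gate comes after
the gates it uses, together with a designated output. Its size is the number of gates. -/
structure SFCircuit (σ : Type*) where
  size : ℕ
  op : Fin size → SFOp
  left : (i : Fin size) → SFOperand σ i
  right : (i : Fin size) → SFOperand σ i
  output : SFOperand σ size

/-- The rational functions in the variables `σ` with rational coefficients. -/
abbrev RationalFunctions (σ : Type*) : Type _ := FractionRing (MvPolynomial σ ℚ)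

namespace SFOp

/-- The operation as a function on a field. -/
def apply {K : Type*} [Field K] : SFOp → K → K → K
  | add, a, b => a + b
  | mul, a, b => a * b
  | div, a, b => a / b

end SFOp

namespace SFOperand

/-- The value of an operand, given the results of the earlier gates. -/
noncomputable def value {σ : Type*} {i : ℕ} (g : Fin i → RationalFunctions σ) :
    SFOperand σ i → RationalFunctions σ
  | var v => algebraMap (MvPolynomial σ ℚ) (RationalFunctions σ) (MvPolynomial.X v)
  | scalar c => ((c : ℕ) : RationalFunctions σ)
  | gate j => g j

end SFOperand

namespace SFCircuit

/-- The rational function computed at gate `i`. -/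
noncomputable def gateValue {σ : Type*} (c : SFCircuit σ) (i : Fin c.size) : RationalFunctions σ :=
  (c.op i).apply
    ((c.left i).value fun j : Fin i => gateValue c ⟨j, j.2.trans i.2⟩)
    ((c.right i).value fun j : Fin i => gateValue c ⟨j, j.2.trans i.2⟩)
termination_by i.1
decreasing_by all_goals exact j.2

/-- The circuit `c` computes `f`: no division gate divides by zero, and the value of the output
is `f`. -/
def Computes {σ : Type*} (c : SFCircuit σ) (f : RationalFunctions σ) : Prop :=
  (∀ i : Fin c.size, c.op i = SFOp.div →
    (c.right i).value (fun j : Fin i => c.gateValue ⟨j, j.2.trans i.2⟩) ≠ 0) ∧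
  c.output.value c.gateValue = f

end SFCircuit

/-! Entries that are too large contribute factors equal to zero, so for suitable `K` the super-Schur
polynomial is a double Schur polynomial in `K` variables, some of them specialized to zero
(`superSchur_eq_doubleSchur`). Removing the boxes with the largest entry turns the tableau sum into
a branching rule (`sum_boundedTableau`). A column reduction of generalized alternants yields the
same rule, so a double Schur polynomial is a quotient of determinants (`doubleAlternant_eq`).

Encode a partition by a strictly increasing sequence. The Desnanot–Jacobi identity then gives a
three-term relation in which deleting an interior term of a segment is expressed through shorter
segments and undeleted ones, with plus signs only (`segmentSchur_three_term`). Allowing one more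
column of the partition deletes exactly one term (`exists_truncSeq_succ`). The algorithm therefore
starts from rectangles, whose polynomials are plain products, and adds one column at a time; each
stage updates O(L²) segment values by at most four operations each, where `L` is `K` plus the number
of columns.

The divisors are nonzero because double Schur polynomials are positive at the all-ones point unless
the shape is too large (`doubleSchur_pos`); the index bounds of the algorithm exclude such shapes.
-/

/-! ### Determinants -/

namespace Matrix

/-- The three-term Plücker relation, in terms of replaced columns. -/
theorem det_mul_det_updateCol_updateCol {n R : Type*} [Fintype n] [DecidableEq n]
    [CommRing R] (A : Matrix n n R) {i j : n} (hij : i ≠ j) (b d : n → R) :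
    A.det * ((A.updateCol i b).updateCol j d).det =
      (A.updateCol i b).det * (A.updateCol j d).det -
        (A.updateCol j b).det * (A.updateCol i d).det := by
  -- Cramer's rule expands `A.det • b` in the columns of `A`. Placed in column `i` of `A.updateCol j
  -- d`, the terms other than `k = i` and `k = j` vanish by a repeated column.
  have hb : A.det • b = ∑ k, (A.updateCol k b).det • A.col k := by
    rw [← mulVec_cramer]
    ext l
    simp [mulVec, dotProduct, cramer_apply, mul_comm]
  have hcr : A.det * ((A.updateCol i b).updateCol j d).det =
      cramer (A.updateCol j d) (A.det • b) i := by
    rw [map_smul, Pi.smul_apply, cramer_apply, updateCol_comm _ hij, smul_eq_mul]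
  rw [hcr, hb, map_sum, Finset.sum_apply,
    Finset.sum_eq_add i j hij _ (fun h => absurd (Finset.mem_univ _) h)
      (fun h => absurd (Finset.mem_univ _) h)]
  · have h1 : (A.updateCol j d).updateCol i (A.col i) = A.updateCol j d := by
      rw [updateCol_comm _ hij.symm]
      congr 1
      exact updateCol_eq_self A i
    have h2 : ((A.updateCol j d).updateCol i (A.col j)).det = -(A.updateCol i d).det := by
      have h3 : (A.updateCol j d).updateCol i (A.col j) =
          (A.updateCol i d).submatrix id (Equiv.swap i j) := by
        ext k l
        rcases eq_or_ne l i with rfl | hi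
        · simp [hij.symm]
        · rcases eq_or_ne l j with rfl | hj
          · simp [hi]
          · simp [hi, hj, Equiv.swap_apply_of_ne_of_ne hi hj]
      rw [h3, det_permute', Equiv.Perm.sign_swap hij]
      simp
    rw [map_smul, map_smul, Pi.smul_apply, Pi.smul_apply, cramer_apply, cramer_apply, h1, h2,
      smul_eq_mul, smul_eq_mul]
    ring
  · rintro k - ⟨hki, hkj⟩
    have h0 : ((A.updateCol j d).updateCol i (A.col k)).det = 0 :=
      det_zero_of_column_eq hki fun l => by simp [hki, hkj]
    rw [map_smul, Pi.smul_apply, cramer_apply, h0, smul_zero]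

theorem det_updateCol_single {n : ℕ} {R : Type*} [CommRing R]
    (A : Matrix (Fin (n + 1)) (Fin (n + 1)) R) (i j : Fin (n + 1)) :
    (A.updateCol i (Pi.single j 1)).det =
      (-1) ^ (j + i : ℕ) * (A.submatrix j.succAbove i.succAbove).det := by
  rw [← adjugate_fin_succ_eq_det_submatrix, ← cramer_apply, cramer_eq_adjugate_mulVec,
    mulVec_single_one]
  rfl

/-- The Desnanot–Jacobi identity. -/
theorem det_mul_det_submatrix_interior {n : ℕ} {R : Type*} [CommRing R]
    (M : Matrix (Fin (n + 2)) (Fin (n + 2)) R) :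
    M.det * (M.submatrix (fun i : Fin n => i.castSucc.succ) fun i => i.castSucc.succ).det =
      (M.submatrix Fin.succ Fin.succ).det * (M.submatrix Fin.castSucc Fin.castSucc).det -
        (M.submatrix Fin.succ Fin.castSucc).det * (M.submatrix Fin.castSucc Fin.succ).det := by
  -- Replacing an outer column by a corner unit vector deletes, up to sign, that column and an outer
  -- row.
  have h := M.det_mul_det_updateCol_updateCol (i := 0) (j := Fin.last (n + 1))
    (by simp [Fin.ext_iff]) (Pi.single 0 1) (Pi.single (Fin.last (n + 1)) 1)
  have h2 : ((M.updateCol 0 (Pi.single 0 1)).updateCol (Fin.last (n + 1))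
      (Pi.single (Fin.last (n + 1)) 1)).det =
      (M.submatrix (fun i : Fin n => i.castSucc.succ) fun i => i.castSucc.succ).det := by
    have h3 : ((M.updateCol 0 (Pi.single 0 1)).submatrix Fin.castSucc Fin.castSucc) =
      (M.submatrix Fin.castSucc Fin.castSucc).updateCol 0 (Pi.single 0 1) := by
      ext i j
      simp only [submatrix_apply, updateCol_apply, Pi.single_apply, Fin.castSucc_eq_zero_iff]
    rw [det_updateCol_single, Fin.succAbove_last, h3, det_updateCol_single, submatrix_submatrix]
    simp [← two_mul, Function.comp_def]
  rw [h2] at h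
  rw [h]
  simp only [det_updateCol_single, Fin.succAbove_last, Fin.succAbove_zero, Fin.val_last,
    Fin.val_zero, add_zero, zero_add, one_mul, ← two_mul,
    (even_two_mul _).neg_one_pow]
  have h4 : ((-1 : R) ^ (n + 1)) * (-1) ^ (n + 1) = 1 := by
    rw [← mul_pow]; simp
  linear_combination -(M.submatrix Fin.succ Fin.castSucc).det *
    (M.submatrix Fin.castSucc Fin.succ).det * h4

theorem det_of_last_row_single {n : ℕ} {R : Type*} [CommRing R]
    (M : Matrix (Fin (n + 1)) (Fin (n + 1)) R) (c : Fin (n + 1))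
    (h : M (Fin.last n) = Pi.single c 1) :
    M.det = (-1) ^ (n + c : ℕ) * (M.submatrix Fin.castSucc c.succAbove).det := by
  rw [det_succ_row M (Fin.last n), Finset.sum_eq_single c]
  · simp [h, Fin.succAbove_last]
  · intro j _ hj
    simp [h, hj]
  · simp

end Matrix

/-! ### Double Schur polynomials -/

section DoubleSchur

variable {R : Type*} [CommRing R]

/-- The sequences `t` interlacing with `s`, that is, `s i ≤ t i < s (i + 1)`. -/
def interlacing {r : ℕ} (s : Fin (r + 1) → ℕ) : Finset (Fin r → ℕ) :=
  Fintype.piFinset fun i => Finset.Ico (s i.castSucc) (s i.succ)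

theorem mem_interlacing {r : ℕ} {s : Fin (r + 1) → ℕ} {t : Fin r → ℕ} :
    t ∈ interlacing s ↔ ∀ i, s i.castSucc ≤ t i ∧ t i < s i.succ := by
  simp [interlacing]

/-- The factor of a double Schur polynomial which comes from the last variable `z`. -/
def branchWeight (y : ℕ → R) (z : R) {r : ℕ} (s : Fin (r + 1) → ℕ) (t : Fin r → ℕ) : R :=
  (∏ q ∈ Finset.range (s 0), (z + y q)) *
    ∏ i, ∏ q ∈ Finset.Ioo (t i) (s i.succ), (z + y q)

/-- The double Schur polynomial in `x 0, …, x (r - 1)` of the partition with parts `s i - i`,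
defined by the branching rule. -/
def doubleSchur (x y : ℕ → R) : (r : ℕ) → (Fin r → ℕ) → R
  | 0, _ => 1
  | r + 1, s => ∑ t ∈ interlacing s, branchWeight y (x r) s t * doubleSchur x y r t

/-- The generalized alternant with columns `(x | y) ^ s j`. -/
def doubleAlternant (x y : ℕ → R) (r : ℕ) (s : Fin r → ℕ) : R :=
  (Matrix.of fun i j : Fin r => ∏ q ∈ Finset.range (s j), (x i.rev + y q)).det

/-- The Vandermonde product, normalized to be the quotient of `doubleAlternant` by
`doubleSchur`. -/
def vandermondeProd (x : ℕ → R) (r : ℕ) : R :=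
  ∏ n ∈ Finset.range r, ∏ i : Fin n, (x i.rev - x n)

/-- An explicit quotient by `x - z` of a difference that vanishes at `x = z`; its summands become
the branching terms. -/
theorem prod_range_sub_prod_range_mul (y : ℕ → R) (x z : R) {a b : ℕ} (h : a ≤ b) :
    ∏ q ∈ Finset.range b, (x + y q) -
        (∏ q ∈ Finset.Ico a b, (z + y q)) * ∏ q ∈ Finset.range a, (x + y q) =
      (x - z) * ∑ t ∈ Finset.Ico a b,
        (∏ q ∈ Finset.Ioo t b, (z + y q)) * ∏ q ∈ Finset.range t, (x + y q) := by
  induction b, h using Nat.le_induction with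
  | base => simp
  | succ b hab ih =>
    have h1 : ∀ t ∈ Finset.Ico a b, (∏ q ∈ Finset.Ioo t (b + 1), (z + y q)) *
        ∏ q ∈ Finset.range t, (x + y q) = (z + y b) * ((∏ q ∈ Finset.Ioo t b, (z + y q)) *
        ∏ q ∈ Finset.range t, (x + y q)) := by
      intro t ht
      have htb := (Finset.mem_Ico.1 ht).2
      have : Finset.Ioo t (b + 1) = insert b (Finset.Ioo t b) := by
        ext q; simp only [Finset.mem_Ioo, Finset.mem_insert]; omega
      rw [this, Finset.prod_insert (by simp), mul_assoc]
    have h2 : Finset.Ioo b (b + 1) = ∅ :=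
      Finset.eq_empty_of_forall_notMem fun q hq => by
        rw [Finset.mem_Ioo] at hq
        omega
    rw [Finset.sum_Ico_succ_top hab, Finset.sum_congr rfl h1, ← Finset.mul_sum,
      Finset.prod_range_succ, Finset.prod_Ico_succ_top hab, h2, Finset.prod_empty]
    linear_combination (z + y b) * ih

/-- Multilinearity in the columns; the transposes appear because `detRowAlternating` is multilinear
in the rows. -/
theorem Matrix.det_of_sum_mul {n : ℕ} (F : ℕ → Fin n → R) (A : Fin n → Finset ℕ)
    (w : Fin n → ℕ → R) :
    (Matrix.of fun i j : Fin n => ∑ t ∈ A j, w j t * F t i).det =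
      ∑ t ∈ Fintype.piFinset A, (∏ j, w j (t j)) * (Matrix.of fun i j => F (t j) i).det := by
  have h := (Matrix.detRowAlternating (n := Fin n) (R := R)).toMultilinearMap.map_sum_finset
    (fun j t => w j t • F t) A
  have h1 : (Matrix.of fun i j : Fin n => ∑ t ∈ A j, w j t * F t i).det =
      Matrix.detRowAlternating fun j => ∑ t ∈ A j, w j t • F t := by
    rw [← Matrix.det_transpose]
    congr 1
    ext i j
    simp
  rw [h1]
  refine h.trans (Finset.sum_congr rfl fun t _ => ?_)
  rw [MultilinearMap.map_smul_univ, smul_eq_mul, ← Matrix.det_transpose]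
  rfl

/-- Row `0` belongs to the last variable `x r`. Subtracting from each column a multiple of its
predecessor clears that row except in column `0`. In the remaining minor each row is divisible by `x
i.rev - x r`, and expanding the quotients by columns gives the sum over interlacing sequences. -/
theorem doubleAlternant_succ (x y : ℕ → R) (r : ℕ) (s : Fin (r + 1) → ℕ) (hs : Monotone s) :
    doubleAlternant x y (r + 1) s = (∏ i : Fin r, (x i.rev - x r)) *
      ∑ t ∈ interlacing s, branchWeight y (x r) s t * doubleAlternant x y r t := by
  have hcol : doubleAlternant x y (r + 1) s = (Matrix.of fun i : Fin (r + 1) =>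
      (Fin.cons (∏ q ∈ Finset.range (s 0), (x i.rev + y q)) fun j : Fin r =>
        ∏ q ∈ Finset.range (s j.succ), (x i.rev + y q) -
        (∏ q ∈ Finset.Ico (s j.castSucc) (s j.succ), (x r + y q)) *
          ∏ q ∈ Finset.range (s j.castSucc), (x i.rev + y q) : Fin (r + 1) → R)).det := by
    refine Matrix.det_eq_of_forall_col_eq_smul_add_pred
      (fun j => ∏ q ∈ Finset.Ico (s j.castSucc) (s j.succ), (x r + y q)) ?_ ?_
    · intro i; simp
    · intro i j; simp
  rw [hcol, Matrix.det_succ_row_zero, Fin.sum_univ_succ, Finset.sum_eq_zero, add_zero]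
  · have hsub : ((Matrix.of fun i : Fin (r + 1) =>
      (Fin.cons (∏ q ∈ Finset.range (s 0), (x i.rev + y q)) fun j : Fin r =>
        ∏ q ∈ Finset.range (s j.succ), (x i.rev + y q) -
        (∏ q ∈ Finset.Ico (s j.castSucc) (s j.succ), (x r + y q)) *
          ∏ q ∈ Finset.range (s j.castSucc), (x i.rev + y q) : Fin (r + 1) → R)).submatrix
          Fin.succ (Fin.succAbove 0)) = Matrix.of fun i j : Fin r => (x i.rev - x r) *
          Matrix.of (fun i j : Fin r => ∑ t ∈ Finset.Ico (s j.castSucc) (s j.succ),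
            (∏ q ∈ Finset.Ioo t (s j.succ), (x r + y q)) *
              ∏ q ∈ Finset.range t, (x i.rev + y q)) i j := by
      ext i j
      have := prod_range_sub_prod_range_mul y (x i.rev) (x r)
        (hs (Fin.castSucc_lt_succ (i := j)).le)
      simpa [Fin.rev_succ] using this
    rw [hsub, Matrix.det_mul_column, Matrix.det_of_sum_mul
      (fun t i => ∏ q ∈ Finset.range t, (x i.rev + y q))
      (fun j => Finset.Ico (s j.castSucc) (s j.succ))
      (fun j t => ∏ q ∈ Finset.Ioo t (s j.succ), (x r + y q))]
    simp only [branchWeight, interlacing, doubleAlternant, mul_assoc, ← Finset.mul_sum]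
    simp
    ring
  · intro j _
    have : ∏ q ∈ Finset.range (s j.succ), (x r + y q) =
        (∏ q ∈ Finset.Ico (s j.castSucc) (s j.succ), (x r + y q)) *
          ∏ q ∈ Finset.range (s j.castSucc), (x r + y q) := by
      rw [mul_comm, Finset.prod_range_mul_prod_Ico _ (hs (Fin.castSucc_lt_succ (i := j)).le)]
    simp [this]

theorem doubleAlternant_eq (x y : ℕ → R) (r : ℕ) (s : Fin r → ℕ) (hs : Monotone s) :
    doubleAlternant x y r s = vandermondeProd x r * doubleSchur x y r s := by
  induction r with
  | zero => simp [doubleAlternant, vandermondeProd, doubleSchur]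
  | succ r ih =>
    rw [doubleAlternant_succ x y r s hs, vandermondeProd, Finset.prod_range_succ, doubleSchur,
      mul_comm (∏ n ∈ Finset.range r, _), mul_assoc]
    congr 1
    rw [Finset.mul_sum]
    refine Finset.sum_congr rfl fun t ht => ?_
    rw [mem_interlacing] at ht
    rw [ih t, vandermondeProd]
    · ring
    · cases r with
      | zero => exact fun i => i.elim0
      | succ r =>
        refine Fin.monotone_iff_le_succ.2 fun i => ?_
        have h1 := (ht i.castSucc).2
        have h2 := (ht i.succ).1
        rw [Fin.succ_castSucc] at h1
        omega

theorem map_doubleSchur {S : Type*} [CommRing S] (f : R →+* S) (x y : ℕ → R) (r : ℕ)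
    (s : Fin r → ℕ) : f (doubleSchur x y r s) = doubleSchur (f ∘ x) (f ∘ y) r s := by
  induction r with
  | zero => simp [doubleSchur]
  | succ r ih => simp [doubleSchur, branchWeight, ih]

end DoubleSchur

/-! ### Three-term relations without subtraction -/

section DoubleSchurRelation

variable {R : Type*} [CommRing R]

/-- Desnanot–Jacobi for the alternant matrix of `w` with a unit row appended at the bottom: minors
keeping that row lose the marked column, minors dropping it keep it. The positions of the marked
column in the two minors with sign differ by one, which turns the minus of the identity into a plus.
-/
theorem doubleAlternant_three_term (x y : ℕ → R) {r : ℕ} (w : Fin (r + 2) → ℕ) (d : Fin r) :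
    doubleAlternant x y (r + 1) (w ∘ d.castSucc.succ.succAbove) *
        doubleAlternant x y r (fun i => w i.castSucc.succ) =
      doubleAlternant x y (r + 1) (w ∘ Fin.castSucc) *
          doubleAlternant x y r (w ∘ Fin.succ ∘ d.castSucc.succAbove) +
        doubleAlternant x y (r + 1) (w ∘ Fin.succ) *
          doubleAlternant x y r (w ∘ Fin.castSucc ∘ d.succ.succAbove) := by
  let M : Matrix (Fin (r + 2)) (Fin (r + 2)) R := Matrix.of fun i j =>
    (Fin.snoc (fun i : Fin (r + 1) => ∏ q ∈ Finset.range (w j), (x i.rev + y q))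
      ((Pi.single d.castSucc.succ 1 : Fin (r + 2) → R) j) : Fin (r + 2) → R) i
  have h0 : M.det = (-1) ^ (r + 1 + (d + 1) : ℕ) *
      doubleAlternant x y (r + 1) (w ∘ d.castSucc.succ.succAbove) := by
    rw [Matrix.det_of_last_row_single M d.castSucc.succ (by ext j; simp [M])]
    congr 2
    ext i j
    simp [M]
  have h1 : (M.submatrix Fin.succ Fin.succ).det = (-1) ^ (r + d : ℕ) *
      doubleAlternant x y r (w ∘ Fin.succ ∘ d.castSucc.succAbove) := by
    rw [Matrix.det_of_last_row_single _ d.castSucc]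
    · congr 2
      ext i j
      simp only [M, Matrix.submatrix_apply, Matrix.of_apply, Fin.succ_castSucc, Fin.snoc_castSucc,
        Fin.rev_succ, Function.comp_apply, Fin.val_castSucc]
    · ext j
      simp only [M, Matrix.submatrix_apply, Matrix.of_apply, Fin.succ_last, Fin.snoc_last,
        Pi.single_apply, Fin.succ_inj]
  have h2 : (M.submatrix Fin.succ Fin.castSucc).det = (-1) ^ (r + (d + 1) : ℕ) *
      doubleAlternant x y r (w ∘ Fin.castSucc ∘ d.succ.succAbove) := by
    rw [Matrix.det_of_last_row_single _ d.succ]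
    · congr 2
      ext i j
      simp only [M, Matrix.submatrix_apply, Matrix.of_apply, Fin.succ_castSucc, Fin.snoc_castSucc,
        Fin.rev_succ, Function.comp_apply, Fin.val_castSucc]
    · ext j
      simp only [M, Matrix.submatrix_apply, Matrix.of_apply, Fin.succ_last, Fin.snoc_last,
        Pi.single_apply, Fin.succ_castSucc, Fin.castSucc_inj]
  have h3 : (M.submatrix Fin.castSucc Fin.castSucc).det =
      doubleAlternant x y (r + 1) (w ∘ Fin.castSucc) := by
    rw [doubleAlternant]
    congr 1
    ext i j
    simp [M]
  have h4 : (M.submatrix Fin.castSucc Fin.succ).det =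
      doubleAlternant x y (r + 1) (w ∘ Fin.succ) := by
    rw [doubleAlternant]
    congr 1
    ext i j
    simp [M]
  have h5 : (M.submatrix (fun i : Fin r => i.castSucc.succ) fun i => i.castSucc.succ).det =
      doubleAlternant x y r (fun i => w i.castSucc.succ) := by
    rw [doubleAlternant]
    congr 1
    ext i j
    simp only [M, Matrix.submatrix_apply, Matrix.of_apply, Fin.succ_castSucc, Fin.snoc_castSucc,
        Fin.rev_succ, Fin.val_castSucc]
  have h := M.det_mul_det_submatrix_interior
  rw [h0, h1, h2, h3, h4, h5] at h
  have h6 : ((-1 : R) ^ (r + d : ℕ)) * (-1) ^ (r + d : ℕ) = 1 := by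
    rw [← mul_pow]; simp
  have h7 : (-1 : R) ^ (r + 1 + (d + 1) : ℕ) = (-1) ^ (r + d : ℕ) := by ring
  have h8 : (-1 : R) ^ (r + (d + 1) : ℕ) = -(-1) ^ (r + d : ℕ) := by ring
  rw [h7, h8] at h
  generalize doubleAlternant x y (r + 1) (w ∘ d.castSucc.succ.succAbove) = a1 at *
  generalize doubleAlternant x y r (fun i => w i.castSucc.succ) = a2 at *
  generalize doubleAlternant x y (r + 1) (w ∘ Fin.castSucc) = a3 at *
  generalize doubleAlternant x y r (w ∘ Fin.succ ∘ d.castSucc.succAbove) = a4 at *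
  generalize doubleAlternant x y (r + 1) (w ∘ Fin.succ) = a5 at *
  generalize doubleAlternant x y r (w ∘ Fin.castSucc ∘ d.succ.succAbove) = a6 at *
  generalize (-1 : R) ^ (r + (d : ℕ)) = e at *
  linear_combination e * h + (a3 * a4 + a5 * a6 - a1 * a2) * h6

theorem vandermondeProd_ne_zero [IsDomain R] (x : ℕ → R) (hx : Function.Injective x) (r : ℕ) :
    vandermondeProd x r ≠ 0 := by
  refine Finset.prod_ne_zero_iff.2 fun n _ => Finset.prod_ne_zero_iff.2 fun i _ => ?_
  rw [sub_ne_zero]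
  exact fun h => (i.rev.2).ne (hx h)

/-- Vandermonde factors can only be cancelled when the variables are distinct, so the relation is
proved for indeterminates over `ℤ` and then specialized. This covers the repeated zeros among the
`superX`. -/
theorem doubleSchur_three_term (x y : ℕ → R) {r : ℕ} (w : Fin (r + 2) → ℕ) (hw : Monotone w)
    (d : Fin r) :
    doubleSchur x y (r + 1) (w ∘ d.castSucc.succ.succAbove) *
        doubleSchur x y r (fun i => w i.castSucc.succ) =
      doubleSchur x y (r + 1) (w ∘ Fin.castSucc) *
          doubleSchur x y r (w ∘ Fin.succ ∘ d.castSucc.succAbove) +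
        doubleSchur x y (r + 1) (w ∘ Fin.succ) *
          doubleSchur x y r (w ∘ Fin.castSucc ∘ d.succ.succAbove) := by
  let X : ℕ → MvPolynomial (ℕ ⊕ ℕ) ℤ := fun i => MvPolynomial.X (Sum.inl i)
  let Y : ℕ → MvPolynomial (ℕ ⊕ ℕ) ℤ := fun i => MvPolynomial.X (Sum.inr i)
  let f : MvPolynomial (ℕ ⊕ ℕ) ℤ →+* R := MvPolynomial.eval₂Hom (Int.castRingHom R) (Sum.elim x y)
  have hX : f ∘ X = x := by ext i; simp [f, X]
  have hY : f ∘ Y = y := by ext i; simp [f, Y]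
  have hinj : Function.Injective X := fun i j h => Sum.inl_injective (MvPolynomial.X_injective h)
  have hV := vandermondeProd_ne_zero X hinj
  have hs : ∀ {n : ℕ} (c : Fin (n + 1)), Monotone c.succAbove := fun c =>
    (Fin.strictMono_succAbove c).monotone
  have hc : ∀ {n : ℕ}, Monotone (Fin.castSucc : Fin n → _) := fun {_} =>
    Fin.strictMono_castSucc.monotone
  have hS : ∀ {n : ℕ}, Monotone (Fin.succ : Fin n → _) := fun {_} =>
    Fin.strictMono_succ.monotone
  have h := doubleAlternant_three_term X Y w d
  rw [doubleAlternant_eq X Y _ _ (hw.comp (hs _)), doubleAlternant_eq X Y _ _ (hw.comp hc),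
    doubleAlternant_eq X Y _ _ (hw.comp hS), doubleAlternant_eq X Y _ _ (hw.comp (hc.comp (hs _))),
    doubleAlternant_eq X Y _ _ (hw.comp (hS.comp (hs _))),
    doubleAlternant_eq X Y _ (fun i : Fin r => w i.castSucc.succ) (hw.comp (hS.comp hc))] at h
  have h' : _ = _ := mul_left_cancel₀ (mul_ne_zero (hV (r + 1)) (hV r)) <|
    show vandermondeProd X (r + 1) * vandermondeProd X r *
        (doubleSchur X Y (r + 1) (w ∘ d.castSucc.succ.succAbove) *
        doubleSchur X Y r (fun i => w i.castSucc.succ)) =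
        vandermondeProd X (r + 1) * vandermondeProd X r *
        (doubleSchur X Y (r + 1) (w ∘ Fin.castSucc) *
          doubleSchur X Y r (w ∘ Fin.succ ∘ d.castSucc.succAbove) +
        doubleSchur X Y (r + 1) (w ∘ Fin.succ) *
          doubleSchur X Y r (w ∘ Fin.castSucc ∘ d.succ.succAbove)) by linear_combination h
  have := congrArg f h'
  simpa only [map_mul, map_add, map_doubleSchur, hX, hY] using this

/-- The double Schur polynomial of the segment of length `r`, starting at `a`, of `u`. -/
def segmentSchur (x y : ℕ → R) (u : ℕ → ℕ) (a r : ℕ) : R :=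
  doubleSchur x y r fun i => u (a + i)

theorem segmentSchur_congr (x y : ℕ → R) {u v : ℕ → ℕ} {a b r : ℕ}
    (h : ∀ i < r, u (a + i) = v (b + i)) :
    segmentSchur x y u a r = segmentSchur x y v b r := by
  unfold segmentSchur
  congr 1
  ext i
  exact h i i.2

/-- Here `v` is `u` without its term `c`, and `c` is interior to the segment of length `r + 2`
starting at `a`. -/
theorem segmentSchur_three_term (x y : ℕ → R) {u v : ℕ → ℕ} (hu : Monotone u) {a r c : ℕ}
    (h1 : a < c) (h2 : c ≤ a + r) (hlt : ∀ i < c, v i = u i) (hge : ∀ i, c ≤ i → v i = u (i + 1)) :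
    segmentSchur x y v a (r + 1) * segmentSchur x y u (a + 1) r =
      segmentSchur x y u a (r + 1) * segmentSchur x y v (a + 1) r +
        segmentSchur x y u (a + 1) (r + 1) * segmentSchur x y v a r := by
  obtain ⟨e, rfl⟩ : ∃ e, c = a + 1 + e := ⟨c - a - 1, by omega⟩
  have h := doubleSchur_three_term x y (r := r) (fun i => u (a + i))
    (fun i j hij => hu (by simpa using hij)) ⟨e, by omega⟩
  have hv : ∀ i, v i = if i < a + 1 + e then u i else u (i + 1) := fun i => by
    split_ifs with hi
    exacts [hlt i hi, hge i (by omega)]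
  unfold segmentSchur
  convert h using 4
  all_goals try refine funext fun i => ?_
  all_goals
    try simp only [hv, Function.comp_apply, Fin.succAbove, Fin.lt_def, apply_ite Fin.val,
      Fin.val_castSucc, Fin.val_succ]
    try split_ifs
  all_goals first
    | rfl
    | (exfalso; omega)
    | (refine congrArg u ?_; omega)

end DoubleSchurRelation

/-! ### Rectangles, positivity and nonvanishing -/

section DoubleSchurValues

variable {R : Type*} [CommRing R]

/-- The double Schur polynomial of a rectangle with as many rows as there are variables. -/
theorem segmentSchur_id (x y : ℕ → R) (a r : ℕ) :
    segmentSchur x y id a r =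
      ∏ i ∈ Finset.range r, ∏ q ∈ Finset.range a, (x i + y q) := by
  induction r with
  | zero => simp [segmentSchur, doubleSchur]
  | succ r ih =>
    -- Consecutive integers leave room for just one interlacing sequence.
    have h : interlacing (fun i : Fin (r + 1) => id (a + (i : ℕ))) =
        {fun i : Fin r => id (a + (i : ℕ))} := by
      ext t
      rw [mem_interlacing, Finset.mem_singleton, funext_iff]
      refine forall_congr' fun i => ?_
      simp only [id, Fin.val_castSucc, Fin.val_succ]
      omega
    rw [segmentSchur, doubleSchur, h, Finset.sum_singleton, Finset.prod_range_succ, ← ih, mul_comm]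
    congr 1
    rw [branchWeight, Finset.prod_eq_one (s := Finset.univ), mul_one]
    · simp
    · intro i _
      refine Finset.prod_eq_one fun q hq => ?_
      rw [Finset.mem_Ioo] at hq
      simp only [id, Fin.val_succ] at hq
      omega

theorem StrictMono.add_le_apply_add {r : ℕ} {s : Fin r → ℕ} (hs : StrictMono s) {i j : ℕ}
    (hij : i + j < r) : s ⟨i, by omega⟩ + j ≤ s ⟨i + j, hij⟩ := by
  induction j with
  | zero => simp
  | succ j ih =>
    have h1 := ih (by omega)
    have h2 : s ⟨i + j, by omega⟩ < s ⟨i + (j + 1), hij⟩ := hs (by simp [Fin.lt_def])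
    omega

theorem branchWeight_nonneg {y : ℕ → ℚ} {z : ℚ} (hz : 0 ≤ z) (hy : ∀ q, 0 ≤ y q) {r : ℕ}
    (s : Fin (r + 1) → ℕ) (t : Fin r → ℕ) : 0 ≤ branchWeight y z s t :=
  mul_nonneg (Finset.prod_nonneg fun q _ => add_nonneg hz (hy q))
    (Finset.prod_nonneg fun _ _ => Finset.prod_nonneg fun q _ => add_nonneg hz (hy q))

theorem doubleSchur_nonneg {x y : ℕ → ℚ} (hx : ∀ i, 0 ≤ x i) (hy : ∀ q, 0 ≤ y q) (r : ℕ)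
    (s : Fin r → ℕ) : 0 ≤ doubleSchur x y r s := by
  induction r with
  | zero => simp [doubleSchur]
  | succ r ih =>
    exact Finset.sum_nonneg fun t _ => mul_nonneg (branchWeight_nonneg (hx r) hy s t) (ih t)

/-- The hypothesis on `s` says that the partition does not contain a `(k + 1) × (m + 1)`
rectangle. -/
theorem doubleSchur_pos {x y : ℕ → ℚ} {k m : ℕ} (hx : ∀ i, 0 ≤ x i) (hy : ∀ q, 0 ≤ y q)
    (hxk : ∀ i < k, 0 < x i) (hym : ∀ q < m, 0 < y q) (r : ℕ) (s : Fin r → ℕ)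
    (hs : StrictMono s) (h : ∀ i : Fin r, (i : ℕ) + k + 1 ≤ r → s i ≤ m + i) :
    0 < doubleSchur x y r s := by
  induction r with
  | zero => simp [doubleSchur]
  | succ r ih =>
    -- One positive summand suffices. This `t` drops the smallest part of the partition: all its
    -- `Ioo` factors are empty and the size hypothesis is inherited.
    let t : Fin r → ℕ := fun i => s i.succ - 1
    have hlt : ∀ i : Fin r, s i.castSucc < s i.succ := fun i => hs Fin.castSucc_lt_succ
    have ht : t ∈ interlacing s := mem_interlacing.2 fun i => by
      have := hlt i
      simp only [t]
      omega
    have htm : StrictMono t := fun i j hij => by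
      have h1 := hlt i
      have h2 : s i.succ < s j.succ := hs (Fin.succ_lt_succ_iff.2 hij)
      simp only [t]
      omega
    refine Finset.sum_pos' (fun t _ => mul_nonneg (branchWeight_nonneg (hx r) hy s t)
      (doubleSchur_nonneg hx hy r t)) ⟨t, ht, mul_pos ?_ (ih t htm ?_)⟩
    · rw [branchWeight, Finset.prod_eq_one (s := Finset.univ), mul_one]
      · refine Finset.prod_pos fun q hq => ?_
        rw [Finset.mem_range] at hq
        rcases lt_or_ge r k with hr | hr
        · exact add_pos_of_pos_of_nonneg (hxk r hr) (hy q)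
        -- Here `x r` may vanish, but the hypothesis at index `r - k` and strict growth force `s 0 ≤
        -- m`, so `y q` is positive.
        · refine add_pos_of_nonneg_of_pos (hx r) (hym q ?_)
          have h1 := h ⟨r - k, by omega⟩ (by simp only; omega)
          have h2 := hs.add_le_apply_add (i := 0) (j := r - k) (by omega)
          simp only [zero_add] at h2
          have h3 : s ⟨0, by omega⟩ = s 0 := rfl
          simp only at h1
          omega
      · intro i _
        refine Finset.prod_eq_one fun q hq => ?_
        rw [Finset.mem_Ioo] at hq
        have := hlt i
        simp only [t] at hq
        omega
    · intro i hi
      have h1 := h i.succ (by rw [Fin.val_succ]; omega)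
      rw [Fin.val_succ] at h1
      simp only [t]
      omega

/-- Evaluation with all variables equal to `1` gives a positive number. -/
theorem doubleSchur_superX_superY_ne_zero {k m r : ℕ} {s : Fin r → ℕ} (hs : StrictMono s)
    (h : ∀ i : Fin r, (i : ℕ) + k + 1 ≤ r → s i ≤ m + i) :
    doubleSchur (superX k m) (superY k m) r s ≠ 0 := by
  intro h0
  have h1 := map_doubleSchur (MvPolynomial.eval fun _ : Fin k ⊕ Fin m => (1 : ℚ))
    (superX k m) (superY k m) r s
  rw [h0, map_zero] at h1
  refine (doubleSchur_pos (k := k) (m := m) ?_ ?_ ?_ ?_ r s hs h).ne h1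
  · intro i
    by_cases hi : i < k <;> simp [superX, hi]
  · intro i
    by_cases hi : i < m <;> simp [superY, hi]
  · intro i hi
    simp [superX, hi]
  · intro i hi
    simp [superY, hi]

end DoubleSchurValues

/-! ### Tableaux with bounded entries -/

section BoundedTableaux

/-- The semistandard tableaux of shape `μ` with entries less than `r`. -/
abbrev BoundedTableau (μ : YoungDiagram) (r : ℕ) : Type :=
  {T : SemistandardYoungTableau μ // ∀ i j, (i, j) ∈ μ → T i j < r}

instance (μ : YoungDiagram) (r : ℕ) : Finite (BoundedTableau μ r) := by
  refine Finite.of_injective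
    (fun T (s : μ.cells) => (⟨T.1 s.1.1 s.1.2, T.2 _ _ ((μ.mem_cells _).1 s.2)⟩ : Fin r)) ?_
  intro T T' h
  refine Subtype.ext (SemistandardYoungTableau.ext fun i j => ?_)
  by_cases hij : (i, j) ∈ μ
  · exact congrArg Fin.val (congrFun h ⟨(i, j), by simpa using hij⟩)
  · rw [T.1.zeros hij, T'.1.zeros hij]

noncomputable instance (μ : YoungDiagram) (r : ℕ) : Fintype (BoundedTableau μ r) :=
  Fintype.ofFinite _

/-- The strictly increasing sequence which encodes the first `r` rows of `μ`. -/
def YoungDiagram.shapeSeq (μ : YoungDiagram) (r : ℕ) (j : Fin r) : ℕ := μ.rowLen j.rev + j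

theorem YoungDiagram.strictMono_shapeSeq (μ : YoungDiagram) (r : ℕ) :
    StrictMono (μ.shapeSeq r) := by
  intro i j hij
  have h : μ.rowLen i.rev ≤ μ.rowLen j.rev := μ.rowLen_anti _ _ (Fin.rev_le_rev.2 hij.le)
  have h' : (i : ℕ) < j := hij
  simp only [shapeSeq]
  omega

theorem YoungDiagram.rowLen_eq_zero {μ : YoungDiagram} {i : ℕ} (h : μ.colLen 0 ≤ i) :
    μ.rowLen i = 0 := by
  by_contra h0
  have := mem_iff_lt_colLen.1 (mem_iff_lt_rowLen.2 (Nat.pos_of_ne_zero h0))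
  omega

theorem YoungDiagram.colLen_le_of_rowLen_eq_zero {μ : YoungDiagram} {i : ℕ} (h : μ.rowLen i = 0) :
    μ.colLen 0 ≤ i := by
  by_contra h0
  have := mem_iff_lt_rowLen.1 (mem_iff_lt_colLen.2 (not_le.1 h0))
  omega

theorem YoungDiagram.eq_of_shapeSeq_eq {μ ν : YoungDiagram} {r : ℕ} (hμ : μ.colLen 0 ≤ r)
    (hν : ν.colLen 0 ≤ r) (h : μ.shapeSeq r = ν.shapeSeq r) : μ = ν := by
  have hrow : ∀ i, μ.rowLen i = ν.rowLen i := fun i => by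
    rcases lt_or_ge i r with hi | hi
    · have h1 := congrFun h (Fin.rev ⟨i, hi⟩)
      simpa [shapeSeq] using h1
    · rw [rowLen_eq_zero (hμ.trans hi), rowLen_eq_zero (hν.trans hi)]
  refine YoungDiagram.ext (Finset.ext fun c => ?_)
  obtain ⟨i, j⟩ := c
  rw [mem_cells, mem_cells, mem_iff_lt_rowLen, mem_iff_lt_rowLen, hrow]

/-- `μ / ν` is a horizontal strip. -/
def YoungDiagram.IsHorizontalStrip (μ ν : YoungDiagram) : Prop :=
  ν ≤ μ ∧ ∀ i, μ.rowLen (i + 1) ≤ ν.rowLen i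

theorem YoungDiagram.rowLen_mono {μ ν : YoungDiagram} (h : ν ≤ μ) (i : ℕ) :
    ν.rowLen i ≤ μ.rowLen i := by
  by_contra h0
  have h1 : (i, μ.rowLen i) ∈ ν := mem_iff_lt_rowLen.2 (not_le.1 h0)
  exact lt_irrefl _ (mem_iff_lt_rowLen.1 (h h1))

theorem YoungDiagram.IsHorizontalStrip.shapeSeq_mem {μ ν : YoungDiagram}
    (h : μ.IsHorizontalStrip ν) (r : ℕ) : ν.shapeSeq r ∈ interlacing (μ.shapeSeq (r + 1)) := by
  rw [mem_interlacing]
  intro i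
  have h1 := h.2 i.rev
  have h2 := rowLen_mono h.1 i.rev
  simp only [shapeSeq, Fin.rev_castSucc, Fin.rev_succ, Fin.val_castSucc, Fin.val_succ]
  omega

theorem YoungDiagram.exists_isHorizontalStrip {μ : YoungDiagram} {r : ℕ}
    (hμ : μ.colLen 0 ≤ r + 1) {t : Fin r → ℕ} (ht : t ∈ interlacing (μ.shapeSeq (r + 1))) :
    ∃ ν : YoungDiagram, μ.IsHorizontalStrip ν ∧ ν.colLen 0 ≤ r ∧ ν.shapeSeq r = t := by
  rw [mem_interlacing] at ht
  -- The candidate row lengths: `shapeSeq` is undone by reversing the index and removing the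
  -- staircase.
  let f : ℕ → ℕ := fun i => if h : i < r then t (Fin.rev ⟨i, h⟩) - (r - (i + 1)) else 0
  have hf : ∀ i, μ.rowLen (i + 1) ≤ f i ∧ f i ≤ μ.rowLen i := fun i => by
    by_cases hi : i < r
    · have h1 := ht (Fin.rev ⟨i, hi⟩)
      simp only [shapeSeq, Fin.rev_castSucc, Fin.rev_succ, Fin.val_castSucc, Fin.val_succ,
        Fin.rev_rev, Fin.val_rev] at h1
      simp only [f, hi, dif_pos]
      omega
    · rw [rowLen_eq_zero (i := i + 1) (by omega)]
      simp [f, hi]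
  have hanti : Antitone f := antitone_nat_of_succ_le fun i => (hf (i + 1)).2.trans (hf i).1
  let ν : YoungDiagram :=
    { cells := μ.cells.filter fun c => c.2 < f c.1
      isLowerSet := by
        rintro ⟨i, j⟩ ⟨i', j'⟩ ⟨hi, hj⟩ hc
        simp only at hi hj
        simp only [Finset.coe_filter, mem_cells, Set.mem_ofPred_eq] at hc ⊢
        exact ⟨μ.up_left_mem hi hj hc.1, (hj.trans_lt hc.2).trans_le (hanti hi)⟩ }
  have hmem : ∀ i j, (i, j) ∈ ν ↔ j < f i := fun i j => by
    rw [← mem_cells, Finset.mem_filter, mem_cells, mem_iff_lt_rowLen]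
    exact ⟨fun h => h.2, fun h => ⟨h.trans_le (hf i).2, h⟩⟩
  have hrow : ∀ i, ν.rowLen i = f i := fun i =>
    eq_of_forall_lt_iff fun j => by rw [← mem_iff_lt_rowLen, hmem]
  refine ⟨ν, ⟨?_, fun i => by rw [hrow]; exact (hf i).1⟩, ?_, ?_⟩
  · exact cells_subset_iff.1 (Finset.filter_subset _ _)
  · exact colLen_le_of_rowLen_eq_zero (by rw [hrow]; simp [f])
  · ext j
    have h1 := ht j
    have h2 := j.2
    have h3 : f j.rev = t j - j := by
      have h4 : f j.rev = t (Fin.rev ⟨j.rev, j.rev.2⟩) - (r - (j.rev + 1)) := dif_pos j.rev.2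
      rw [h4, Fin.eta, Fin.rev_rev, Fin.val_rev]
      omega
    simp only [shapeSeq, Fin.rev_castSucc, Fin.rev_succ, Fin.val_castSucc, Fin.val_succ,
      Fin.val_rev] at h1
    simp only [shapeSeq, hrow, h3]
    omega

variable {R : Type*} [CommRing R]

/-- The weight `∏_s (x_{T(s)} + y_{T(s) + C(s)})` of a tableau. -/
def tableauWeight (x y : ℕ → R) {μ : YoungDiagram} (T : SemistandardYoungTableau μ) : R :=
  ∏ s ∈ μ.cells, (x (T s.1 s.2) + y (T s.1 s.2 + s.2 - s.1))

/-- Extend a tableau by a horizontal strip with all entries equal to `r`. -/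
noncomputable def BoundedTableau.extend {μ ν : YoungDiagram} {r : ℕ} (h : μ.IsHorizontalStrip ν)
    (T : BoundedTableau ν r) : BoundedTableau μ (r + 1) := by
  classical
  exact
  ⟨{ entry := fun i j => if (i, j) ∈ ν then T.1 i j else if (i, j) ∈ μ then r else 0
     row_weak' := by
      intro i j1 j2 hj hc
      by_cases h2 : (i, j2) ∈ ν
      · rw [if_pos h2, if_pos (ν.up_left_mem le_rfl hj.le h2)]
        exact T.1.row_weak hj h2
      · rw [if_neg h2, if_pos hc]
        split_ifs with h3 h4
        exacts [(T.2 _ _ h3).le, le_rfl, Nat.zero_le _]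
     col_strict' := by
      intro i1 i2 j hi hc
      -- A horizontal strip has at most one box per column, so any box above a box of `μ` lies in
      -- `ν`.
      have h1 : (i1, j) ∈ ν := YoungDiagram.mem_iff_lt_rowLen.2
        (((YoungDiagram.mem_iff_lt_rowLen.1 hc).trans_le (μ.rowLen_anti _ _ hi)).trans_le (h.2 i1))
      rw [if_pos h1]
      split_ifs with h2
      exacts [T.1.col_strict hi h2, T.2 _ _ h1]
     zeros' := by
      intro i j hij
      rw [if_neg fun h' => hij (h.1 h'), if_neg hij] }, by
    intro i j hij
    change (if (i, j) ∈ ν then T.1 i j else if (i, j) ∈ μ then r else 0) < r + 1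
    split_ifs with h1
    exacts [(T.2 _ _ h1).trans (Nat.lt_succ_self r), Nat.lt_succ_self r]⟩

open Classical in
theorem BoundedTableau.extend_apply {μ ν : YoungDiagram} {r : ℕ} (h : μ.IsHorizontalStrip ν)
    (T : BoundedTableau ν r) (i j : ℕ) :
    (T.extend h).1 i j = if (i, j) ∈ ν then T.1 i j else if (i, j) ∈ μ then r else 0 :=
  rfl

theorem BoundedTableau.mem_iff_extend_lt {μ ν : YoungDiagram} {r : ℕ} (h : μ.IsHorizontalStrip ν)
    (T : BoundedTableau ν r) (i j : ℕ) :
    (i, j) ∈ ν ↔ (i, j) ∈ μ ∧ (T.extend h).1 i j < r := by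
  rw [extend_apply]
  constructor
  · intro h1
    rw [if_pos h1]
    exact ⟨h.1 h1, T.2 _ _ h1⟩
  · rintro ⟨h1, h2⟩
    by_contra h3
    rw [if_neg h3, if_pos h1] at h2
    exact lt_irrefl _ h2

theorem BoundedTableau.extend_injective {μ ν : YoungDiagram} {r : ℕ}
    (h : μ.IsHorizontalStrip ν) :
    Function.Injective (BoundedTableau.extend h : BoundedTableau ν r → _) := by
  intro T T' hT
  refine Subtype.ext (SemistandardYoungTableau.ext fun i j => ?_)
  by_cases hij : (i, j) ∈ ν
  · have h1 : (T.extend h).1 i j = (T'.extend h).1 i j := by rw [hT]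
    rwa [extend_apply, extend_apply, if_pos hij, if_pos hij] at h1
  · rw [T.1.zeros hij, T'.1.zeros hij]

/-- The boxes with entry below `r` form `ν`; column strictness makes the rest a horizontal strip,
and `row_le_entry` bounds the number of rows of `ν`. -/
theorem BoundedTableau.exists_extend_eq {μ : YoungDiagram} {r : ℕ}
    (T : BoundedTableau μ (r + 1)) : ∃ (ν : YoungDiagram) (h : μ.IsHorizontalStrip ν)
      (T' : BoundedTableau ν r), ν.colLen 0 ≤ r ∧ T'.extend h = T := by
  let ν : YoungDiagram :=
    { cells := μ.cells.filter fun c => T.1 c.1 c.2 < r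
      isLowerSet := by
        rintro ⟨i, j⟩ ⟨i', j'⟩ ⟨hi, hj⟩ hc
        simp only at hi hj
        simp only [Finset.coe_filter, YoungDiagram.mem_cells, Set.mem_ofPred_eq] at hc ⊢
        exact ⟨μ.up_left_mem hi hj hc.1, ((T.1.col_weak hi (μ.up_left_mem le_rfl hj hc.1)).trans
          (T.1.row_weak_of_le hj hc.1)).trans_lt hc.2⟩ }
  have hmem : ∀ i j, (i, j) ∈ ν ↔ (i, j) ∈ μ ∧ T.1 i j < r := fun i j => by
    rw [← YoungDiagram.mem_cells, Finset.mem_filter, YoungDiagram.mem_cells]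
  have hstrip : μ.IsHorizontalStrip ν := by
    refine ⟨YoungDiagram.cells_subset_iff.1 (Finset.filter_subset _ _), fun i => ?_⟩
    by_contra hlt
    have h1 : (i + 1, ν.rowLen i) ∈ μ := YoungDiagram.mem_iff_lt_rowLen.2 (not_le.1 hlt)
    have h2 := T.1.col_strict (Nat.lt_add_one i) h1
    have h3 := T.2 _ _ h1
    have h4 : (i, ν.rowLen i) ∈ ν :=
      (hmem _ _).2 ⟨μ.up_left_mem (Nat.le_succ i) le_rfl h1, by omega⟩
    exact lt_irrefl _ (YoungDiagram.mem_iff_lt_rowLen.1 h4)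
  classical
  let T' : BoundedTableau ν r :=
    ⟨{ entry := fun i j => if (i, j) ∈ ν then T.1 i j else 0
       row_weak' := by
        intro i j1 j2 hj hc
        rw [if_pos hc, if_pos (ν.up_left_mem le_rfl hj.le hc)]
        exact T.1.row_weak hj ((hmem _ _).1 hc).1
       col_strict' := by
        intro i1 i2 j hi hc
        rw [if_pos hc, if_pos (ν.up_left_mem hi.le le_rfl hc)]
        exact T.1.col_strict hi ((hmem _ _).1 hc).1
       zeros' := fun hij => if_neg hij }, by
      intro i j hij
      change (if (i, j) ∈ ν then T.1 i j else 0) < r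
      rw [if_pos hij]
      exact ((hmem _ _).1 hij).2⟩
  refine ⟨ν, hstrip, T', ?_, ?_⟩
  · by_contra hlt
    have h1 := (hmem _ _).1 (YoungDiagram.mem_iff_lt_colLen.2 (not_le.1 hlt))
    exact absurd (T.1.row_le_entry h1.1) (not_le.2 h1.2)
  · refine Subtype.ext (SemistandardYoungTableau.ext fun i j => ?_)
    rw [extend_apply]
    split_ifs with h1 h2
    · exact if_pos h1
    · have h3 := T.2 _ _ h2
      have h4 : ¬ T.1 i j < r := fun h => h1 ((hmem _ _).2 ⟨h2, h⟩)
      omega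
    · exact (T.1.zeros h2).symm

/-- The strip boxes in row `i` give consecutive indices of `y`, shifted by `r - i`. The staircase
for `ν` is one step shorter than that for `μ`, hence the open left end in `branchWeight`; the bottom
row `r` gives its `range` factor. -/
theorem prod_horizontalStrip (y : ℕ → R) (z : R) {μ ν : YoungDiagram} {r : ℕ}
    (hμ : μ.colLen 0 ≤ r + 1) (hν : ν.colLen 0 ≤ r) :
    ∏ s ∈ μ.cells \ ν.cells, (z + y (r + s.2 - s.1)) =
      branchWeight y z (μ.shapeSeq (r + 1)) (ν.shapeSeq r) := by
  have h1 := Finset.prod_finset_product' (μ.cells \ ν.cells) (Finset.range (r + 1))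
    (fun i => Finset.Ico (ν.rowLen i) (μ.rowLen i)) (by
      rintro ⟨i, j⟩
      rw [Finset.mem_sdiff, YoungDiagram.mem_cells, YoungDiagram.mem_cells,
        YoungDiagram.mem_iff_lt_rowLen, YoungDiagram.mem_iff_lt_rowLen, Finset.mem_Ico,
        Finset.mem_range]
      simp only
      constructor
      · rintro ⟨h1, h2⟩
        refine ⟨?_, by omega, h1⟩
        by_contra hi
        rw [YoungDiagram.rowLen_eq_zero (i := i) (by omega)] at h1
        omega
      · rintro ⟨_, h2, h3⟩
        exact ⟨h3, by omega⟩)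
    (f := fun i j => z + y (r + j - i))
  have h2 : ∀ i ≤ r, ∏ j ∈ Finset.Ico (ν.rowLen i) (μ.rowLen i), (z + y (r + j - i)) =
      ∏ q ∈ Finset.Ico (ν.rowLen i + (r - i)) (μ.rowLen i + (r - i)), (z + y q) := by
    intro i hi
    rw [← Finset.prod_Ico_add' (fun q => z + y q)]
    refine Finset.prod_congr rfl fun j _ => ?_
    rw [show r + j - i = j + (r - i) by omega]
  rw [h1, Finset.prod_range, ← Equiv.prod_comp Fin.revPerm, Fin.prod_univ_succ, branchWeight]
  congr 1
  · rw [h2 _ (by simp)]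
    rw [Finset.range_eq_Ico, Fin.revPerm_apply, Fin.rev_zero, Fin.val_last,
      YoungDiagram.rowLen_eq_zero hν, Nat.sub_self, YoungDiagram.shapeSeq, Fin.rev_zero,
      Fin.val_last, Fin.val_zero]
  · refine Finset.prod_congr rfl fun i _ => ?_
    rw [h2 _ (by simp)]
    refine Finset.prod_congr ?_ fun _ _ => rfl
    ext q
    have := i.2
    simp only [Finset.mem_Ico, Finset.mem_Ioo, YoungDiagram.shapeSeq, Fin.revPerm_apply,
      Fin.rev_succ, Fin.val_castSucc, Fin.val_succ, Fin.val_rev]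
    omega

theorem tableauWeight_extend (x y : ℕ → R) {μ ν : YoungDiagram} {r : ℕ}
    (hμ : μ.colLen 0 ≤ r + 1) (hν : ν.colLen 0 ≤ r) (h : μ.IsHorizontalStrip ν)
    (T : BoundedTableau ν r) : tableauWeight x y (T.extend h).1 =
      branchWeight y (x r) (μ.shapeSeq (r + 1)) (ν.shapeSeq r) * tableauWeight x y T.1 := by
  rw [tableauWeight, ← Finset.prod_sdiff (YoungDiagram.cells_subset_iff.2 h.1),
    ← prod_horizontalStrip y (x r) hμ hν, tableauWeight]
  congr 1
  · refine Finset.prod_congr rfl fun s hs => ?_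
    rw [Finset.mem_sdiff, YoungDiagram.mem_cells, YoungDiagram.mem_cells] at hs
    rw [BoundedTableau.extend_apply, if_neg hs.2, if_pos hs.1]
  · refine Finset.prod_congr rfl fun s hs => ?_
    rw [YoungDiagram.mem_cells] at hs
    rw [BoundedTableau.extend_apply, if_pos hs]

/-- Tableaux with entries at most `r` are sorted by the shape of their entries below `r`; these
shapes correspond to the interlacing sequences. -/
theorem sum_boundedTableau (x y : ℕ → R) (r : ℕ) (μ : YoungDiagram) (hμ : μ.colLen 0 ≤ r) :
    ∑ T : BoundedTableau μ r, tableauWeight x y T.1 = doubleSchur x y r (μ.shapeSeq r) := by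
  induction r generalizing μ with
  | zero =>
    have hmem : ∀ c, c ∉ μ := fun c hc => by
      have h1 := YoungDiagram.mem_iff_lt_rowLen.1 (show (c.1, c.2) ∈ μ from hc)
      rw [YoungDiagram.rowLen_eq_zero (i := c.1) (by omega)] at h1
      omega
    have hcells : μ.cells = ∅ := Finset.eq_empty_of_forall_notMem fun c hc =>
      hmem c ((μ.mem_cells c).1 hc)
    have hsub : Subsingleton (BoundedTableau μ 0) := ⟨fun T T' =>
      Subtype.ext (SemistandardYoungTableau.ext fun i j => by
        rw [T.1.zeros (hmem _), T'.1.zeros (hmem _)])⟩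
    let T : BoundedTableau μ 0 := ⟨default, fun i j h => absurd h (hmem _)⟩
    rw [Fintype.sum_subsingleton _ T, tableauWeight, hcells, Finset.prod_empty, doubleSchur]
  | succ r ih =>
    have hex := fun t : interlacing (μ.shapeSeq (r + 1)) =>
      YoungDiagram.exists_isHorizontalStrip hμ t.2
    choose ν hstrip hcol hseq using hex
    rw [doubleSchur, ← Finset.sum_coe_sort (interlacing (μ.shapeSeq (r + 1)))]
    have h1 : ∀ t : interlacing (μ.shapeSeq (r + 1)),
        branchWeight y (x r) (μ.shapeSeq (r + 1)) t * doubleSchur x y r t =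
        ∑ T : BoundedTableau (ν t) r, tableauWeight x y (T.extend (hstrip t)).1 := fun t => by
      simp only [tableauWeight_extend x y hμ (hcol t), ← Finset.mul_sum]
      rw [ih _ (hcol t), hseq]
    rw [Finset.sum_congr rfl fun t _ => h1 t, ← Fintype.sum_sigma']
    symm
    refine Fintype.sum_bijective
      (fun p : (t : interlacing (μ.shapeSeq (r + 1))) × BoundedTableau (ν t) r =>
        p.2.extend (hstrip p.1)) ⟨?_, ?_⟩ _ _ fun _ => rfl
    · rintro ⟨t, T⟩ ⟨t', T'⟩ h
      simp only at h
      have h2 : ν t = ν t' := by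
        refine YoungDiagram.ext (Finset.ext fun c => ?_)
        rw [YoungDiagram.mem_cells, YoungDiagram.mem_cells, T.mem_iff_extend_lt (hstrip t), h,
          ← T'.mem_iff_extend_lt (hstrip t')]
      obtain rfl : t = t' := Subtype.ext (by rw [← hseq t, ← hseq t', h2])
      rw [BoundedTableau.extend_injective (hstrip t) h]
    · intro T
      obtain ⟨ν', h, T', hcol', rfl⟩ := T.exists_extend_eq
      obtain ⟨t, rfl⟩ : ∃ t, ν t = ν' := ⟨⟨_, h.shapeSeq_mem r⟩,
        YoungDiagram.eq_of_shapeSeq_eq (hcol _) hcol' (hseq _)⟩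
      exact ⟨⟨t, T'⟩, rfl⟩

/-- An entry at least `r` has `x`-index at least `k`, and `y`-index at least `r - (μ.colLen 0 - 1) ≥
m`, so its factor is zero. -/
theorem superSchur_eq_doubleSchur {k m r : ℕ} {μ : YoungDiagram} (hk : k ≤ r)
    (hm : m + μ.colLen 0 ≤ r + 1) (hr : μ.colLen 0 ≤ r) :
    superSchur k m μ = doubleSchur (superX k m) (superY k m) r (μ.shapeSeq r) := by
  rw [← sum_boundedTableau _ _ r μ hr, superSchur]
  have hsupp : (Function.support (superTableauWeight k m : SemistandardYoungTableau μ → _)) ⊆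
      {T | ∀ i j, (i, j) ∈ μ → T i j < r} := by
    intro T hT i j hij
    by_contra hlt
    refine hT (Finset.prod_eq_zero ((μ.mem_cells _).2 hij) ?_)
    have h0 := YoungDiagram.mem_iff_lt_colLen.1 (μ.up_left_mem le_rfl (Nat.zero_le j) hij)
    have h1 : ¬ T i j < k := by omega
    have h2 : ¬ T i j + j - i < m := by omega
    simp [superX, superY, h1, h2]
  rw [← finsum_eq_sum_of_fintype, finsum_subtype_eq_finsum_cond (f := tableauWeight _ _)]
  classical
  refine finsum_congr fun T => ?_
  by_cases hT : ∀ i j, (i, j) ∈ μ → T i j < r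
  · rw [finsum_eq_if (p := ∀ i j, (i, j) ∈ μ → T i j < r), if_pos hT]
    rfl
  · rw [finsum_eq_if (p := ∀ i j, (i, j) ∈ μ → T i j < r), if_neg hT]
    exact Function.notMem_support.1 fun h => hT (hsupp h)

end BoundedTableaux

/-! ### Straight-line programs -/

section StraightLine

variable {F : Type*} [Field F]

/-- The values `g 0, …, g (N - 1)` are computed one after the other from the inputs `I`, each with
one operation and without division by zero. -/
def IsStraightLine (I : Set F) (N : ℕ) (g : ℕ → F) : Prop :=
  ∀ i < N, ∃ (o : SFOp) (a b : F), (a ∈ I ∨ ∃ j < i, g j = a) ∧ (b ∈ I ∨ ∃ j < i, g j = b) ∧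
    (o = SFOp.div → b ≠ 0) ∧ g i = o.apply a b

/-- The values available after a straight-line program. Here `0` comes for free: a program never
needs to compute with it. -/
def availableValues (I : Set F) (N : ℕ) (g : ℕ → F) : Set F :=
  {v | v = 0 ∨ v ∈ I ∨ ∃ j < N, g j = v}

/-- Every straight-line program that computes `A` can be extended by at most `c` operations to one
that also computes `B`. -/
def Derivable (I : Set F) (c : ℕ) (A B : Set F) : Prop :=
  ∀ N g, IsStraightLine I N g → A ⊆ availableValues I N g →
    ∃ N' g', IsStraightLine I N' g' ∧ N' ≤ N + c ∧
      availableValues I N g ⊆ availableValues I N' g' ∧ B ⊆ availableValues I N' g'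

namespace Derivable

variable {I A A' B B' C : Set F} {c d : ℕ} {a b : F}

theorem mono (h : Derivable I c A B) (hcd : c ≤ d) (hA : A ⊆ A') (hB : B' ⊆ B) :
    Derivable I d A' B' := fun N g hg hN => by
  obtain ⟨N', g', h1, h2, h3, h4⟩ := h N g hg (hA.trans hN)
  exact ⟨N', g', h1, h2.trans (by omega), h3, hB.trans h4⟩

theorem of_subset (h : B ⊆ A) : Derivable I c A B := fun N g hg hN =>
  ⟨N, g, hg, Nat.le_add_right N c, subset_rfl, h.trans hN⟩

theorem of_mem (h : a ∈ A) : Derivable I c A {a} := of_subset (Set.singleton_subset_iff.2 h)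

theorem of_mem_inputs (h : a ∈ I) : Derivable I c A {a} := fun N g hg _ =>
  ⟨N, g, hg, Nat.le_add_right N c, subset_rfl, Set.singleton_subset_iff.2 (Or.inr (Or.inl h))⟩

theorem zero : Derivable I c A {0} := fun N g hg _ =>
  ⟨N, g, hg, Nat.le_add_right N c, subset_rfl, Set.singleton_subset_iff.2 (Or.inl rfl)⟩

theorem trans (h : Derivable I c A B) (h' : Derivable I d (A ∪ B) C) :
    Derivable I (c + d) A (B ∪ C) := fun N g hg hN => by
  obtain ⟨N1, g1, h1, h2, h3, h4⟩ := h N g hg hN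
  obtain ⟨N2, g2, k1, k2, k3, k4⟩ := h' N1 g1 h1 (Set.union_subset (hN.trans h3) h4)
  exact ⟨N2, g2, k1, by omega, h3.trans k3, Set.union_subset (h4.trans k3) k4⟩

theorem iterate {B : ℕ → Set F} (n : ℕ)
    (h : ∀ i < n, Derivable I c (A ∪ {v | ∃ j < i, v ∈ B j}) (B i)) :
    Derivable I (n * c) A {v | ∃ j < n, v ∈ B j} := by
  induction n with
  | zero => exact of_subset fun v ⟨j, hj, _⟩ => absurd hj (Nat.not_lt_zero j)
  | succ n ih =>
    refine ((ih fun i hi => h i (hi.trans (Nat.lt_succ_self n))).trans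
      (h n (Nat.lt_succ_self n))).mono (by rw [Nat.succ_mul]) subset_rfl ?_
    rintro v ⟨j, hj, hv⟩
    rcases (Nat.lt_succ_iff_lt_or_eq.1 hj) with hj | rfl
    exacts [Or.inl ⟨j, hj, hv⟩, Or.inr hv]

/-- The value `0` counts as available but need not be an actual operand, hence the hypotheses;
`add`, `mul` and `div` treat zero operands separately, without a gate. -/
theorem apply (o : SFOp) (ha : a ≠ 0) (hb : b ≠ 0) : Derivable I 1 {a, b} {o.apply a b} := by
  intro N g hg hN
  have hlt : ∀ j < N, Function.update g N (o.apply a b) j = g j := fun j hj =>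
    Function.update_of_ne hj.ne _ _
  have hop : ∀ v ∈ ({a, b} : Set F), v ≠ 0 →
      v ∈ I ∨ ∃ j < N, Function.update g N (o.apply a b) j = v := fun v hv hv0 => by
    rcases hN hv with h | h | ⟨j, hj, h⟩
    exacts [absurd h hv0, Or.inl h, Or.inr ⟨j, hj, (hlt j hj).trans h⟩]
  refine ⟨N + 1, Function.update g N (o.apply a b), ?_, le_rfl, ?_, ?_⟩
  · intro i hi
    rcases Nat.lt_succ_iff_lt_or_eq.1 hi with hi | rfl
    · obtain ⟨o', u, v, hu, hv, h1, h2⟩ := hg i hi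
      refine ⟨o', u, v, hu.imp_right ?_, hv.imp_right ?_, h1, (hlt i hi).trans h2⟩
      all_goals exact fun ⟨j, hj, h⟩ => ⟨j, hj, (hlt j (hj.trans hi)).trans h⟩
    · exact ⟨o, a, b, hop a (by simp) ha, hop b (by simp) hb, fun _ => hb, by simp⟩
  · rintro v (h | h | ⟨j, hj, h⟩)
    exacts [Or.inl h, Or.inr (Or.inl h),
      Or.inr (Or.inr ⟨j, hj.trans (Nat.lt_succ_self N), (hlt j hj).trans h⟩)]
  · exact Set.singleton_subset_iff.2 (Or.inr (Or.inr ⟨N, Nat.lt_succ_self N, by simp⟩))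

theorem of_pair {v : F} (h : Derivable I 1 {a, b} {v}) (ha : Derivable I c A {a})
    (hb : Derivable I d A {b}) : Derivable I (c + d + 1) A {v} := by
  refine ((ha.trans (hb.mono le_rfl Set.subset_union_left subset_rfl)).trans
    (h.mono le_rfl ?_ subset_rfl)).mono le_rfl subset_rfl Set.subset_union_right
  rintro _ (rfl | rfl)
  exacts [Or.inr (Or.inl rfl), Or.inr (Or.inr rfl)]

theorem add (ha : Derivable I c A {a}) (hb : Derivable I d A {b}) :
    Derivable I (c + d + 1) A {a + b} := by
  refine of_pair ?_ ha hb
  by_cases ha0 : a = 0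
  · exact of_mem (by simp [ha0])
  by_cases hb0 : b = 0
  · exact of_mem (by simp [hb0])
  exact apply SFOp.add ha0 hb0

theorem mul (ha : Derivable I c A {a}) (hb : Derivable I d A {b}) :
    Derivable I (c + d + 1) A {a * b} := by
  refine of_pair ?_ ha hb
  by_cases ha0 : a = 0
  · exact of_mem (by simp [ha0])
  by_cases hb0 : b = 0
  · exact of_mem (by simp [hb0])
  exact apply SFOp.mul ha0 hb0

theorem div (ha : Derivable I c A {a}) (hb : Derivable I d A {b}) (hb0 : b ≠ 0) :
    Derivable I (c + d + 1) A {a / b} := by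
  refine of_pair ?_ ha hb
  by_cases ha0 : a = 0
  · exact of_mem (by simp [ha0])
  exact apply SFOp.div ha0 hb0

end Derivable

end StraightLine

/-- The values which a subtraction-free circuit can use as operands without any gate. -/
def circuitInputs (σ : Type*) : Set (RationalFunctions σ) :=
  Set.range (fun v => algebraMap (MvPolynomial σ ℚ) (RationalFunctions σ) (MvPolynomial.X v)) ∪
    Set.range (fun c : ℕ+ => ((c : ℕ) : RationalFunctions σ))

theorem exists_operand {σ : Type*} {i : ℕ} {g : ℕ → RationalFunctions σ}
    {a : RationalFunctions σ} (ha : a ∈ circuitInputs σ ∨ ∃ j < i, g j = a) :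
    ∃ p : SFOperand σ i, p.value (fun j : Fin i => g j) = a := by
  rcases ha with (⟨v, rfl⟩ | ⟨c, rfl⟩) | ⟨j, hj, rfl⟩
  exacts [⟨.var v, rfl⟩, ⟨.scalar c, rfl⟩, ⟨.gate ⟨j, hj⟩, rfl⟩]

theorem Derivable.exists_circuit {σ : Type*} {n : ℕ} {f : RationalFunctions σ}
    (h : Derivable (circuitInputs σ) n ∅ {f}) (hf : f ≠ 0) :
    ∃ c : SFCircuit σ, c.Computes f ∧ c.size ≤ n := by
  obtain ⟨N, g, hg, hN, -, hfg⟩ := h 0 (fun _ => 0) (fun i hi => absurd hi (Nat.not_lt_zero i))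
    (Set.empty_subset _)
  obtain ⟨out, hout⟩ := exists_operand ((hfg rfl).resolve_left hf)
  have hgate : ∀ i : Fin N, ∃ (o : SFOp) (p q : SFOperand σ i),
      (o = SFOp.div → q.value (fun j : Fin i => g j) ≠ 0) ∧
      g i = o.apply (p.value fun j : Fin i => g j) (q.value fun j : Fin i => g j) := fun i => by
    obtain ⟨o, a, b, ha, hb, h0, hi⟩ := hg i i.2
    obtain ⟨p, rfl⟩ := exists_operand ha
    obtain ⟨q, rfl⟩ := exists_operand hb
    exact ⟨o, p, q, h0, hi⟩
  choose o p q h0 hval using hgate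
  let c : SFCircuit σ := ⟨N, o, p, q, out⟩
  have hc : ∀ (i : ℕ) (hi : i < N), c.gateValue ⟨i, hi⟩ = g i := fun i => by
    induction i using Nat.strong_induction_on with
    | _ i ih =>
      intro hi
      have hfun : (fun j : Fin i => c.gateValue ⟨j, j.2.trans hi⟩) = fun j : Fin i => g j :=
        funext fun j => ih j j.2 (j.2.trans hi)
      rw [SFCircuit.gateValue]
      exact (congrArg (fun G => (o ⟨i, hi⟩).apply ((p ⟨i, hi⟩).value G) ((q ⟨i, hi⟩).value G))
        hfun).trans (hval ⟨i, hi⟩).symm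
  refine ⟨c, ⟨fun i hi => ?_, ?_⟩, by simpa using hN⟩
  · have hfun : (fun j : Fin i => c.gateValue ⟨j, j.2.trans i.2⟩) = fun j : Fin i => g j :=
      funext fun j => hc j _
    rw [hfun]
    exact h0 i hi
  · have hfun : c.gateValue = fun j : Fin N => g j := funext fun j => hc j j.2
    rw [hfun]
    exact hout

/-! ### The algorithm, one column at a time -/

section SegmentAlgorithm

/-- The increasing sequence which encodes the partition with (weakly increasing) parts `ρ`,
truncated to its first `p` columns. -/
def truncSeq (ρ : ℕ → ℕ) (p j : ℕ) : ℕ := j + min (ρ j) p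

theorem strictMono_truncSeq {ρ : ℕ → ℕ} (hρ : Monotone ρ) (p : ℕ) : StrictMono (truncSeq ρ p) :=
  strictMono_id.add_monotone (hρ.min monotone_const)

/-- Passing from `p` to `p + 1` columns deletes one term of the sequence. -/
theorem exists_truncSeq_succ {ρ : ℕ → ℕ} (hρ : Monotone ρ) {p : ℕ} (h : ∃ i, p < ρ i) :
    ∃ c, (∀ i < c, truncSeq ρ (p + 1) i = truncSeq ρ p i) ∧
      ∀ i, c ≤ i → truncSeq ρ (p + 1) i = truncSeq ρ p (i + 1) := by
  classical
  refine ⟨Nat.find h, fun i hi => ?_, fun i hi => ?_⟩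
  · have := Nat.find_min h hi
    simp only [truncSeq]
    omega
  · have h1 := (Nat.find_spec h).trans_le (hρ hi)
    have h2 := hρ (Nat.le_succ i)
    simp only [truncSeq]
    rw [Nat.succ_eq_add_one] at h2
    omega

variable {F : Type*} [Field F] (x y : ℕ → F) (ρ : ℕ → ℕ) (K L : ℕ)

/-- The values computed by the stage `p` of the algorithm. -/
def stageValues (p : ℕ) : Set F :=
  {v | ∃ a r, r ≤ K ∧ a + r + p ≤ L ∧ v = segmentSchur x y (truncSeq ρ p) a r}

variable {x y ρ K L} {I : Set F}

theorem derivable_stageValues_zero (hKL : K ≤ L) (h1 : (1 : F) ∈ I)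
    (hx : ∀ i, x i = 0 ∨ x i ∈ I) (hy : ∀ i, y i = 0 ∨ y i ∈ I) :
    Derivable I (3 * (L + 1) ^ 2) ∅ (stageValues x y ρ K L 0) := by
  have hvar : ∀ {z : F} {A : Set F}, z = 0 ∨ z ∈ I → Derivable I 0 A {z} := by
    rintro z A (rfl | hz)
    exacts [Derivable.zero, Derivable.of_mem_inputs hz]
  have hcol : Derivable I ((L + 1) * ((L + 1) * 2)) ∅ {v | ∃ i < L + 1, v ∈ {v | ∃ a < L + 1,
      v ∈ ({∏ q ∈ Finset.range a, (x i + y q)} : Set F)}} := by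
    -- Two operations per partial product in one variable; `hrect` then needs one more per
    -- rectangle.
    refine Derivable.iterate _ fun i _ => Derivable.iterate _ fun a _ => ?_
    cases a with
    | zero => exact Derivable.of_mem_inputs (by simpa using h1)
    | succ a =>
      rw [Finset.prod_range_succ]
      refine (Derivable.of_mem (c := 0) ?_).mul ((hvar (hx i)).add (hvar (hy a)))
      exact Or.inr ⟨a, Nat.lt_succ_self a, rfl⟩
  have hrect : Derivable I ((L + 1) * ((L + 1) * 1)) {v | ∃ i < L + 1, v ∈ {v | ∃ a < L + 1,
      v ∈ ({∏ q ∈ Finset.range a, (x i + y q)} : Set F)}} {v | ∃ a < L + 1, v ∈ {v | ∃ r < L + 1,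
      v ∈ ({∏ i ∈ Finset.range r, ∏ q ∈ Finset.range a, (x i + y q)} : Set F)}} := by
    refine Derivable.iterate _ fun a ha => Derivable.iterate _ fun r hr => ?_
    cases r with
    | zero => exact Derivable.of_mem_inputs (by simpa using h1)
    | succ r =>
      rw [Finset.prod_range_succ]
      refine (Derivable.of_mem (c := 0) ?_).mul (Derivable.of_mem (c := 0) ?_)
      · exact Or.inr ⟨r, Nat.lt_succ_self r, rfl⟩
      · exact Or.inl (Or.inl ⟨r, by omega, a, ha, rfl⟩)
  refine (hcol.trans (hrect.mono le_rfl Set.subset_union_right subset_rfl)).mono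
    (by ring_nf; rfl) subset_rfl ?_
  rintro _ ⟨a, r, hr, ha, rfl⟩
  have hid : truncSeq ρ 0 = id := funext fun j => by simp [truncSeq]
  rw [hid, segmentSchur_id]
  exact Or.inr ⟨a, by omega, r, by omega, rfl⟩

/-- No operand in the recursion has a larger `a + r + p` than its target, so the bound by `L` is
preserved. -/
theorem derivable_stageValues_succ (hKL : K ≤ L) (hρ : Monotone ρ) {p : ℕ} (hp : ∃ i, p < ρ i)
    (hne : ∀ a r, r + 1 ≤ K → a + r + p + 2 ≤ L →
      segmentSchur x y (truncSeq ρ p) (a + 1) r ≠ 0) :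
    Derivable I (4 * (L + 1) ^ 2) (stageValues x y ρ K L p) (stageValues x y ρ K L (p + 1)) := by
  obtain ⟨c, hlt, hge⟩ := exists_truncSeq_succ hρ hp
  have h : Derivable I ((K + 1) * ((L + 1) * 4)) (stageValues x y ρ K L p)
      {v | ∃ r < K + 1, v ∈ {v | ∃ a < L + 1, v ∈ {v | a + r + (p + 1) ≤ L ∧
        v = segmentSchur x y (truncSeq ρ (p + 1)) a r}}} := by
    -- The length is the outer loop, since the recursion uses shorter segments of the new stage. If
    -- the deleted term `c` is not interior, the value is already an old one, possibly shifted.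
    refine Derivable.iterate _ fun r hr => Derivable.iterate _ fun a ha => ?_
    by_cases hcond : a + r + (p + 1) ≤ L
    swap
    · exact Derivable.of_subset fun v hv => absurd hv.1 hcond
    suffices h : Derivable I 4 _ {segmentSchur x y (truncSeq ρ (p + 1)) a r} from
      h.mono le_rfl subset_rfl fun v hv => hv.2
    rcases le_or_gt c a with hca | hac
    · rw [segmentSchur_congr x y (v := truncSeq ρ p) (b := a + 1) fun i _ => by
        rw [hge _ (by omega)]; congr 1; omega]
      exact Derivable.of_mem (Or.inl (Or.inl ⟨a + 1, r, by omega, by omega, rfl⟩))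
    rcases le_or_gt (a + r) c with hac' | hca
    · rw [segmentSchur_congr x y (v := truncSeq ρ p) (b := a) fun i _ => hlt _ (by omega)]
      exact Derivable.of_mem (Or.inl (Or.inl ⟨a, r, by omega, by omega, rfl⟩))
    obtain ⟨r, rfl⟩ : ∃ n, r = n + 1 := ⟨r - 1, by omega⟩
    have h0 := hne a r (by omega) (by omega)
    rw [eq_div_of_mul_eq h0 (segmentSchur_three_term x y (strictMono_truncSeq hρ p).monotone hac
      (by omega) hlt hge)]
    have hold : ∀ a' r', r' ≤ K → a' + r' + p ≤ L → segmentSchur x y (truncSeq ρ p) a' r' ∈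
        stageValues x y ρ K L p := fun a' r' h1 h2 => ⟨a', r', h1, h2, rfl⟩
    refine (((Derivable.of_mem (c := 0) ?_).mul (Derivable.of_mem (c := 0) ?_)).add
      ((Derivable.of_mem (c := 0) ?_).mul (Derivable.of_mem (c := 0) ?_))).div
      (Derivable.of_mem (c := 0) ?_) h0
    · exact Or.inl (Or.inl (hold _ _ (by omega) (by omega)))
    · exact Or.inl (Or.inr ⟨r, by omega, a + 1, by omega, by omega, rfl⟩)
    · exact Or.inl (Or.inl (hold _ _ (by omega) (by omega)))
    · exact Or.inl (Or.inr ⟨r, by omega, a, by omega, by omega, rfl⟩)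
    · exact Or.inl (Or.inl (hold _ _ (by omega) (by omega)))
  refine h.mono (by nlinarith [Nat.zero_le L]) subset_rfl ?_
  rintro _ ⟨a, r, hr, ha, rfl⟩
  exact ⟨r, by omega, a, by omega, ha, rfl⟩

theorem derivable_stageValues (hKL : K ≤ L) (h1 : (1 : F) ∈ I)
    (hx : ∀ i, x i = 0 ∨ x i ∈ I) (hy : ∀ i, y i = 0 ∨ y i ∈ I) (hρ : Monotone ρ) (P : ℕ)
    (hP : ∀ p < P, ∃ i, p < ρ i)
    (hne : ∀ p a r, r + 1 ≤ K → a + r + p + 2 ≤ L →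
      segmentSchur x y (truncSeq ρ p) (a + 1) r ≠ 0) :
    Derivable I ((3 + 4 * P) * (L + 1) ^ 2) ∅ (stageValues x y ρ K L P) := by
  induction P with
  | zero => exact derivable_stageValues_zero hKL h1 hx hy
  | succ P ih =>
    refine ((ih fun p hp => hP p (hp.trans (Nat.lt_succ_self P))).trans
      ((derivable_stageValues_succ hKL hρ (hP P (Nat.lt_succ_self P)) (hne P)).mono le_rfl
        Set.subset_union_right subset_rfl)).mono ?_ subset_rfl Set.subset_union_right
    exact le_of_eq (by ring)

end SegmentAlgorithm

/-! ### Assembly of the circuit and the size bound -/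

theorem exists_circuit_superSchur {k m K L : ℕ} {μ : YoungDiagram}
    (hL : L = K + μ.rowLen 0) (hk : k ≤ K) (hm : m + μ.colLen 0 ≤ K + 1) (hK : μ.colLen 0 ≤ K)
    (hKL : K = k ∨ L = k + m + 2) (hμ : μ.rowLen k ≤ m) :
    ∃ c : SFCircuit (Fin k ⊕ Fin m),
      c.Computes (algebraMap (MvPolynomial (Fin k ⊕ Fin m) ℚ)
        (RationalFunctions (Fin k ⊕ Fin m)) (superSchur k m μ)) ∧
      c.size ≤ 4 * (L + 1) ^ 3 := by
  let φ := algebraMap (MvPolynomial (Fin k ⊕ Fin m) ℚ) (RationalFunctions (Fin k ⊕ Fin m))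
  have hφ : Function.Injective φ := IsFractionRing.injective _ _
  -- Truncated subtraction extends the reversed parts by the constant `μ.rowLen 0` from `j = K` on;
  -- the segments may reach beyond `K`.
  let ρ : ℕ → ℕ := fun j => μ.rowLen (K - (j + 1))
  have hρ : Monotone ρ := fun i j hij => μ.rowLen_anti _ _ (by omega)
  have hmap : ∀ p a r, segmentSchur (φ ∘ superX k m) (φ ∘ superY k m) (truncSeq ρ p) a r =
      φ (doubleSchur (superX k m) (superY k m) r fun i => truncSeq ρ p (a + i)) := fun p a r =>
    (map_doubleSchur φ _ _ _ _).symm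
  have hseq : (fun i : Fin K => truncSeq ρ (μ.rowLen 0) (0 + i)) = μ.shapeSeq K := funext fun i => by
    have h := μ.rowLen_anti 0 (K - (i + 1)) (Nat.zero_le _)
    simp only [truncSeq, ρ, YoungDiagram.shapeSeq, zero_add, Fin.val_rev]
    omega
  have hne : superSchur k m μ ≠ 0 := by
    rw [superSchur_eq_doubleSchur hk hm hK]
    refine doubleSchur_superX_superY_ne_zero (μ.strictMono_shapeSeq K) fun i hi => ?_
    have h := μ.rowLen_anti k (i.rev : Fin K) (by rw [Fin.val_rev]; omega)
    simp only [YoungDiagram.shapeSeq]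
    omega
  have hstage := derivable_stageValues (I := circuitInputs (Fin k ⊕ Fin m))
    (x := φ ∘ superX k m) (y := φ ∘ superY k m) (K := K) (L := L) (by omega)
    (Or.inr ⟨1, by simp⟩) (fun i => ?_) (fun i => ?_) hρ (μ.rowLen 0) (fun p hp => ⟨K, ?_⟩)
    (fun p a r hr ha => ?_)
  · obtain ⟨c, hc, hsize⟩ := (hstage.mono (le_refl _) subset_rfl
      (Set.singleton_subset_iff.2 (show φ (superSchur k m μ) ∈ _ from
        ⟨0, K, le_rfl, by omega, by rw [hmap, hseq, superSchur_eq_doubleSchur hk hm hK]⟩))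
      ).exists_circuit ((map_ne_zero_iff φ hφ).2 hne)
    refine ⟨c, hc, hsize.trans ?_⟩
    rw [pow_succ _ 2, mul_comm ((L + 1) ^ 2), ← mul_assoc]
    exact Nat.mul_le_mul_right _ (by omega)
  · by_cases hi : i < k
    · exact Or.inr (Or.inl ⟨Sum.inl ⟨i, hi⟩, by simp [φ, superX, hi]⟩)
    · exact Or.inl (by simp [superX, hi])
  · by_cases hi : i < m
    · exact Or.inr (Or.inl ⟨Sum.inr ⟨i, hi⟩, by simp [φ, superY, hi]⟩)
    · exact Or.inl (by simp [superY, hi])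
  · simpa [ρ] using hp
  -- Nonvanishing of the divisors: if `K = k`, segments are too short for the size condition to
  -- bite; if `L = k + m + 2`, then `r ≥ k + 1` and the bound on `a + r + p` give `a + 1 + p ≤ m`.
  · rw [hmap]
    refine (map_ne_zero_iff φ hφ).2 (doubleSchur_superX_superY_ne_zero
      (fun i j hij => strictMono_truncSeq hρ p (Nat.add_lt_add_left hij _)) fun i hi => ?_)
    simp only [truncSeq]
    omega

theorem theorem4p3 :
    ∃ C : ℕ, ∀ (k m : ℕ) (μ : YoungDiagram),
      μ.rowLen 0 + μ.colLen 0 ≤ k + 2 →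
      (m = 0 → μ.colLen 0 ≤ k) →
      ∃ c : SFCircuit (Fin k ⊕ Fin m),
        c.Computes (algebraMap (MvPolynomial (Fin k ⊕ Fin m) ℚ)
          (RationalFunctions (Fin k ⊕ Fin m)) (superSchur k m μ)) ∧
        c.size ≤ C * (k + m) ^ 3 := by
  refine ⟨500, fun k m μ hμ h0 => ?_⟩
  -- Without variables no gate is allowed; the polynomial is then the scalar `1`.
  rcases Nat.eq_zero_or_pos (k + m) with hkm | hkm
  · obtain ⟨rfl, rfl⟩ : k = 0 ∧ m = 0 := by omega
    have hcol := h0 rfl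
    rw [superSchur_eq_doubleSchur (r := 0) le_rfl (by omega) hcol, doubleSchur, map_one]
    obtain ⟨c, hc, hsize⟩ := Derivable.exists_circuit (n := 0)
      (Derivable.of_mem_inputs (Or.inr ⟨1, by simp⟩)) (one_ne_zero' (RationalFunctions _))
    exact ⟨c, hc, hsize.trans (Nat.zero_le _)⟩
  -- If `μ` has more than `k` rows, then its first row has at most one box, and `h0` excludes `m =
  -- 0`.
  · have hrow : μ.rowLen k ≤ m := by
      rcases le_or_gt (μ.colLen 0) k with h | h
      · rw [YoungDiagram.rowLen_eq_zero h]
        exact Nat.zero_le m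
      · have := μ.rowLen_anti 0 k (Nat.zero_le k)
        omega
    -- For `μ.rowLen 0 ≤ m + 2` this `K` makes `L = k + m + 2`; otherwise `K = k` and `L ≤ 2 * k +
    -- 2`. Either way `L + 1 ≤ 5 * (k + m)`, whence `500 = 4 * 5 ^ 3`.
    obtain ⟨c, hc, hsize⟩ := exists_circuit_superSchur (k := k) (m := m) (μ := μ)
      (K := k + (m + 2 - μ.rowLen 0)) rfl (by omega) (by omega) (by omega) (by omega) hrow
    refine ⟨c, hc, hsize.trans ?_⟩
    calc 4 * (k + (m + 2 - μ.rowLen 0) + μ.rowLen 0 + 1) ^ 3 ≤ 4 * (5 * (k + m)) ^ 3 :=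
          Nat.mul_le_mul_left 4 (Nat.pow_le_pow_left (by omega) 3)
      _ = 500 * (k + m) ^ 3 := by ring
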